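/- Let $0 \le h < 1/\sqrt2$, and let $d = d(n)$ be at least polylogarithmic in $n$ with exponent larger than one: there are $a > 1$ and $C > 0$ with $d(n) \ge C(\log n)^a$ for all sufficiently large $n$. For each $n$ consider random matrices $\Lambda, \Omega \in \mathbb{R}^{n\times n}$ generated as follows. All entries of $\Lambda$ are zero except $\Lambda_{i,i+1}$, $1 \le i \le n-1$, which are independent and uniformly distributed on $[-h,h]$ (for $h=0$: equal to $0$ almost surely). $\Omega_{i,j} = \langle v_i, v_j\rangle$, where $v_1$ is uniform on the unit sphere of $\mathbb{R}^{d}$ and, for $i \ge 2$, conditionally on $v_1,\dots,v_{i-1}$, the vector $v_i$ is uniform on the unit sphere of the hyperplane orthogonal to $v_{i-1}$. (The joint law of $\Lambda$ and $(v_i)_i$ may be arbitrary; in particular they may be independent.) Put $\Sigma = (I-\Lambda)^{-T}\,\Omega\,(I-\Lambda)^{-1}$. Then there are real sequences $\zeta_h(n)$, $\chi_h(n)$, $\delta_{1,n}$, $\delta_{2,n}$, depending only on $h$, the function $d$ and $n$, such that $0 \le \zeta_h(n) \le h + o(1)$; if $h > 0$, then $\chi_h(n) \ge c\,n^{-2}$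 for some $c > 0$ and all large $n$; $\delta_{1,n} \to 0$ and $\delta_{2,n}\to 0$ as $n \to \infty$; and for every sufficiently large $n$ we have $0 \le \delta_{1,n}, \delta_{2,n} < \tfrac12$, $$\mathbb{P}\Big[\forall i:\ |\Sigma_{i-1,i}|,\ |\Sigma_{i,i+1}|,\ |\Sigma_{i-1,i+1}| \le \zeta_h(n)\, \Sigma_{i,i}\Big] \ge 1-\delta_{1,n}$$ and $$\mathbb{P}\Big[\forall\, 1 \le i \le n-1:\ |\Lambda_{i,i+1}| \ge \chi_h(n)\Big] \ge 1-\delta_{2,n}.$$ In the first event $i$ ranges over $\{1,\dots,n\}$, and for each $i$ only those of the three inequalities are required whose indices lie in $\{1,\dots,n\}$. -/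

import Mathlib

open MeasureTheory ProbabilityTheory Filter Topology

noncomputable section

/-- The uniform distribution on the interval `[-h, h]`; for `h = 0` it is the point mass at `0`. -/
def uniformSymm (h : ℝ) : Measure ℝ :=
  if h = 0 then Measure.dirac 0 else volume[|Set.Icc (-h) h]

/-- The uniform distribution on the unit sphere of a linear subspace `W` of `ℝ^d`: the surface
measure of the unit sphere of `W`, normalised to total mass one, viewed as a measure on `ℝ^d`. -/
def unitSphereUniform {d : ℕ} (W : Submodule ℝ (EuclideanSpace ℝ (Fin d))) :
    Measure (EuclideanSpace ℝ (Fin d)) :=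
  (((volume : Measure W).toSphere Set.univ)⁻¹ • (volume : Measure W).toSphere).map
    (fun x : Metric.sphere (0 : W) 1 => ((x : W) : EuclideanSpace ℝ (Fin d)))

/-- `Λ` is a random weight matrix of the directed path on `n` vertices: the only entries that are
not zero are `Λ i (i + 1)`, and these are independent and uniformly distributed on `[-h, h]`. -/
structure IsRandomPathWeights {S : Type*} [MeasurableSpace S] (P : Measure S) {n : ℕ} (h : ℝ)
    (Λ : S → Matrix (Fin n) (Fin n) ℝ) : Prop where
  zero : ∀ (s : S) (i j : Fin n), (i : ℕ) + 1 ≠ j → Λ s i j = 0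
  law : ∀ i j : Fin n, (i : ℕ) + 1 = j → HasLaw (fun s => Λ s i j) (uniformSymm h) P
  indep : iIndepFun
    (fun (e : {e : Fin n × Fin n // (e.1 : ℕ) + 1 = e.2}) (s : S) => Λ s e.1.1 e.1.2) P

/-- `v` is a random sequence of `n` unit vectors of `ℝ^d`: the first one is uniform on the unit
sphere, and the conditional distribution of each further one, given all the previous ones, is
uniform on the unit sphere of the subspace orthogonal to its immediate predecessor. -/
structure IsRandomUnitVectors {S : Type*} [MeasurableSpace S] (P : Measure S) {n d : ℕ}
    (v : Fin n → S → EuclideanSpace ℝ (Fin d)) : Prop where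
  first : ∀ i : Fin n, (i : ℕ) = 0 → HasLaw (v i) (unitSphereUniform ⊤) P
  next : ∀ i j : Fin n, (i : ℕ) + 1 = j →
    ∃ κ : Kernel ({k : Fin n // k < j} → EuclideanSpace ℝ (Fin d)) (EuclideanSpace ℝ (Fin d)),
      IsMarkovKernel κ ∧
      HasCondDistrib (v j) (fun s (k : {k : Fin n // k < j}) => v k s) κ P ∧
      ∀ᵐ s ∂P, κ (fun k => v k s) =
        unitSphereUniform (Submodule.span ℝ {v i s})ᗮ

/-- The data covariance matrix `Σ = (I - Λ)⁻ᵀ Ω (I - Λ)⁻¹` of a linear structural equation model. -/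
def dataCovariance {n : ℕ} (Λ Ω : Matrix (Fin n) (Fin n) ℝ) : Matrix (Fin n) (Fin n) ℝ :=
  ((1 - Λ)⁻¹).transpose * Ω * (1 - Λ)⁻¹

/-- For every `i`, each of `|M (i-1) i|`, `|M i (i+1)|`, `|M (i-1) (i+1)|` whose indices lie in the
range is at most `ζ * M i i`. -/
def LocallyDominated {n : ℕ} (ζ : ℝ) (M : Matrix (Fin n) (Fin n) ℝ) : Prop :=
  ∀ i : Fin n,
    (∀ j : Fin n, (j : ℕ) + 1 = i → |M j i| ≤ ζ * M i i) ∧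
    (∀ k : Fin n, (i : ℕ) + 1 = k → |M i k| ≤ ζ * M i i) ∧
    (∀ j k : Fin n, (j : ℕ) + 1 = i → (i : ℕ) + 1 = k → |M j k| ≤ ζ * M i i)

end

/-!
Put `w j = v j + Λ (j - 1) j • w (j - 1)`. Then `Σ` is the Gram matrix of `w`. By concentration of
measure on spheres and a union bound, with high probability the `v i` are almost orthogonal to each
other, so that `w (j - 1)` is almost orthogonal to `v j`. Writing `l = Λ (j - 1) j`, this gives, up
to `o(1)`, `‖w j‖² = 1 + l² ‖w (j - 1)‖² ≤ 1 / (1 - h²)` and `⟪w (j - 1), w j⟫ = l ‖w (j - 1)‖²`.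
The decisive inequality `|⟪w (j - 1), w j⟫| ≤ h ‖w j‖²` then reduces to `l (1 - h l) ≤ h (1 - h²)`
for `0 ≤ l ≤ h`, which holds because `h² ≤ 1 / 2`.

The weights are not too small by another union bound: a uniform weight satisfies `|l| < h c` with
probability at most `c`, and `c = n⁻²` beats the number of edges.
-/

open scoped InnerProductSpace

/-! ### Concentration on the sphere -/

section Cap

variable {E : Type*} [NormedAddCommGroup E] [InnerProductSpace ℝ E]

lemma smul_mem_closedBall_of_le_inner {u y : E} (hu : ‖u‖ ≤ 1) (hy : ‖y‖ = 1) {τ r : ℝ}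
    (hτ : 0 ≤ τ) (hτ2 : τ ^ 2 ≤ 1 / 2) (hr : 0 ≤ r) (hr1 : r ≤ 1) (huy : τ ≤ ⟪u, y⟫_ℝ) :
    r • y ∈ Metric.closedBall (τ • u) √(1 - τ ^ 2) := by
  rw [mem_closedBall_iff_norm]
  apply Real.le_sqrt_of_sq_le
  have expand : ‖r • y - τ • u‖ ^ 2 = r ^ 2 - 2 * (r * τ * ⟪u, y⟫_ℝ) + τ ^ 2 * ‖u‖ ^ 2 := by
    rw [norm_sub_sq_real, norm_smul, norm_smul, real_inner_smul_left, real_inner_smul_right,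
      real_inner_comm, hy, mul_pow, mul_pow, Real.norm_eq_abs, Real.norm_eq_abs, sq_abs, sq_abs]
    ring
  calc ‖r • y - τ • u‖ ^ 2 ≤ r ^ 2 - 2 * (r * τ * τ) + τ ^ 2 * 1 := by
        rw [expand]
        gcongr
        exact pow_le_one₀ (norm_nonneg u) hu
    _ ≤ 1 - τ ^ 2 := by nlinarith

variable [FiniteDimensional ℝ E] [MeasurableSpace E] [BorelSpace E]

/- The cone over a cap of height `τ` lies in a ball of radius `√(1 - τ²)`, which compares the two
volumes. -/
lemma toSphere_cap_le (μ : Measure E) [μ.IsAddHaarMeasure] {u : E} (hu : ‖u‖ ≤ 1) {τ : ℝ}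
    (hτ : 0 ≤ τ) (hτ2 : τ ^ 2 ≤ 1 / 2) :
    μ.toSphere {y | τ ≤ ⟪u, (y : E)⟫_ℝ} ≤
      ENNReal.ofReal (√(1 - τ ^ 2) ^ Module.finrank ℝ E) * μ.toSphere Set.univ := by
  have hmeas : MeasurableSet {y : Metric.sphere (0 : E) 1 | τ ≤ ⟪u, (y : E)⟫_ℝ} :=
    (isClosed_le continuous_const (by fun_prop)).measurableSet
  rw [Measure.toSphere_apply' _ hmeas, Measure.toSphere_apply_univ, mul_left_comm,
    ← Measure.addHaar_closedBall μ (τ • u) (Real.sqrt_nonneg _)]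
  gcongr
  rintro _ ⟨r, hr, _, ⟨y, hy, rfl⟩, rfl⟩
  exact smul_mem_closedBall_of_le_inner hu (by simp) hτ hτ2 hr.1.le hr.2.le hy

lemma toSphere_abs_cap_le (μ : Measure E) [μ.IsAddHaarMeasure] {u : E} (hu : ‖u‖ ≤ 1) {τ : ℝ}
    (hτ : 0 ≤ τ) (hτ2 : τ ^ 2 ≤ 1 / 2) :
    μ.toSphere {y | τ ≤ |⟪u, (y : E)⟫_ℝ|} ≤
      ENNReal.ofReal (2 * √(1 - τ ^ 2) ^ Module.finrank ℝ E) * μ.toSphere Set.univ := by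
  have hunion : {y : Metric.sphere (0 : E) 1 | τ ≤ |⟪u, (y : E)⟫_ℝ|} =
      {y : Metric.sphere (0 : E) 1 | τ ≤ ⟪u, (y : E)⟫_ℝ} ∪ {y | τ ≤ ⟪-u, (y : E)⟫_ℝ} := by
    ext y
    simp [le_abs, inner_neg_left]
  rw [hunion, two_mul, ENNReal.ofReal_add (by positivity) (by positivity), add_mul]
  exact (measure_union_le _ _).trans <|
    add_le_add (toSphere_cap_le μ hu hτ hτ2) (toSphere_cap_le μ (by simpa using hu) hτ hτ2)

end Cap

lemma sqrt_one_sub_sq_pow_le_exp (τ : ℝ) (m : ℕ) :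
    √(1 - τ ^ 2) ^ m ≤ Real.exp (-(m * τ ^ 2 / 2)) := by
  have hsqrt : √(1 - τ ^ 2) ≤ Real.exp (-τ ^ 2 / 2) := by
    rw [Real.exp_half]
    exact Real.sqrt_le_sqrt (Real.one_sub_le_exp_neg _)
  calc √(1 - τ ^ 2) ^ m ≤ Real.exp (-τ ^ 2 / 2) ^ m := by gcongr
    _ = Real.exp (-(m * τ ^ 2 / 2)) := by rw [← Real.exp_nat_mul]; congr 1; ring

section UnitSphereUniform

variable {d : ℕ} (W : Submodule ℝ (EuclideanSpace ℝ (Fin d)))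

lemma unitSphereUniform_apply {B : Set (EuclideanSpace ℝ (Fin d))} (hB : MeasurableSet B) :
    unitSphereUniform W B = ((volume : Measure W).toSphere Set.univ)⁻¹ *
      (volume : Measure W).toSphere {x | ((x : W) : EuclideanSpace ℝ (Fin d)) ∈ B} := by
  rw [unitSphereUniform, Measure.map_apply (by fun_prop : Continuous _).measurable hB,
    Measure.smul_apply, smul_eq_mul]
  rfl

lemma measurableSet_norm_ne_one : MeasurableSet {x : EuclideanSpace ℝ (Fin d) | ‖x‖ ≠ 1} :=
  (measurableSet_eq_fun measurable_norm measurable_const).compl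

lemma unitSphereUniform_norm_ne_one : unitSphereUniform W {x | ‖x‖ ≠ 1} = 0 := by
  have hnorm (x : Metric.sphere (0 : W) 1) : ‖((x : W) : EuclideanSpace ℝ (Fin d))‖ = 1 :=
    mem_sphere_zero_iff_norm.1 x.2
  simp [unitSphereUniform_apply W measurableSet_norm_ne_one, hnorm, -Submodule.coe_norm]

lemma unitSphereUniform_abs_inner_ge_le {u : EuclideanSpace ℝ (Fin d)} (hu : ‖u‖ ≤ 1) {τ : ℝ}
    (hτ : 0 ≤ τ) (hτ2 : τ ^ 2 ≤ 1 / 2) :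
    unitSphereUniform W {x | τ ≤ |⟪u, x⟫_ℝ|} ≤
      ENNReal.ofReal (2 * Real.exp (-(Module.finrank ℝ W * τ ^ 2 / 2))) := by
  have hmeas : MeasurableSet {x : EuclideanSpace ℝ (Fin d) | τ ≤ |⟪u, x⟫_ℝ|} :=
    (isClosed_le continuous_const (by fun_prop)).measurableSet
  have hproj : ‖W.orthogonalProjectionOnto u‖ ≤ 1 :=
    (W.norm_orthogonalProjectionOnto_apply_le u).trans hu
  have hinner (x : W) : ⟪u, (x : EuclideanSpace ℝ (Fin d))⟫_ℝ =
      ⟪W.orthogonalProjectionOnto u, x⟫_ℝ := by simp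
  simp only [unitSphereUniform_apply W hmeas, Set.mem_ofPred_eq, hinner]
  calc _ ≤ ((volume : Measure W).toSphere Set.univ)⁻¹ *
        (ENNReal.ofReal (2 * √(1 - τ ^ 2) ^ Module.finrank ℝ W) *
          (volume : Measure W).toSphere Set.univ) := by
        gcongr
        exact toSphere_abs_cap_le _ hproj hτ hτ2
    _ = ENNReal.ofReal (2 * √(1 - τ ^ 2) ^ Module.finrank ℝ W) *
        (((volume : Measure W).toSphere Set.univ)⁻¹ *
          (volume : Measure W).toSphere Set.univ) := by ring
    _ ≤ ENNReal.ofReal (2 * √(1 - τ ^ 2) ^ Module.finrank ℝ W) :=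
        mul_le_of_le_one_right' (ENNReal.inv_mul_le_one _)
    _ ≤ ENNReal.ofReal (2 * Real.exp (-(Module.finrank ℝ W * τ ^ 2 / 2))) := by
        gcongr
        exact sqrt_one_sub_sq_pow_le_exp τ _

lemma pred_le_finrank_orthogonal_span_singleton (x : EuclideanSpace ℝ (Fin d)) :
    d - 1 ≤ Module.finrank ℝ (Submodule.span ℝ {x})ᗮ := by
  have hsum := (Submodule.span ℝ {x}).finrank_add_finrank_orthogonal
  have hspan : Module.finrank ℝ (Submodule.span ℝ {x}) ≤ 1 := by
    simpa using finrank_span_le_card (R := ℝ) ({x} : Set (EuclideanSpace ℝ (Fin d)))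
  rw [finrank_euclideanSpace_fin] at hsum
  omega

end UnitSphereUniform

/-! ### Almost orthonormality of the random vectors -/

lemma measure_le_of_ae_condDistrib_le {S 𝓧 𝓨 : Type*} [MeasurableSpace S] [MeasurableSpace 𝓧]
    [MeasurableSpace 𝓨] {P : Measure S} [IsProbabilityMeasure P] {X : S → 𝓧} {Y : S → 𝓨}
    {κ : Kernel 𝓧 𝓨} [IsSFiniteKernel κ] (hXY : HasCondDistrib Y X κ P) {B : Set (𝓧 × 𝓨)}
    (hB : MeasurableSet B) {c : ENNReal}
    (hc : ∀ᵐ s ∂P, κ (X s) (Prod.mk (X s) ⁻¹' B) ≤ c) :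
    P {s | (X s, Y s) ∈ B} ≤ c := by
  have hX : AEMeasurable X P := hXY.aemeasurable_fst
  have : IsProbabilityMeasure (P.map X) := Measure.isProbabilityMeasure_map hX
  calc P {s | (X s, Y s) ∈ B} = ((P.map X) ⊗ₘ κ) B := HasLaw.measure_eq hXY (p := (· ∈ B)) hB
    _ = ∫⁻ x, κ x (Prod.mk x ⁻¹' B) ∂(P.map X) := Measure.compProd_apply hB
    _ = ∫⁻ s, κ (X s) (Prod.mk (X s) ⁻¹' B) ∂P :=
        lintegral_map' (Kernel.measurable_kernel_prodMk_left hB).aemeasurable hX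
    _ ≤ ∫⁻ _, c ∂P := lintegral_mono_ae hc
    _ = c := by simp

/-- A quantitative weakening of `Orthonormal`: unit vectors whose pairwise inner products are at
most `τ` in absolute value. -/
structure IsAlmostOrthonormal {ι E : Type*} [NormedAddCommGroup E] [InnerProductSpace ℝ E]
    (τ : ℝ) (v : ι → E) : Prop where
  norm_eq_one : ∀ i, ‖v i‖ = 1
  abs_inner_le : Pairwise fun i j => |⟪v i, v j⟫_ℝ| ≤ τ

/-- Given its predecessors, each of the random unit vectors `v i` except the first is uniform on the
unit sphere of a subspace of dimension at least `m`, which may depend on the predecessors. -/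
structure IsConditionallySpherical {S : Type*} [MeasurableSpace S] (P : Measure S) {n d : ℕ}
    (m : ℕ) (v : Fin n → S → EuclideanSpace ℝ (Fin d)) : Prop where
  norm_first : ∀ i : Fin n, (i : ℕ) = 0 → ∀ᵐ s ∂P, ‖v i s‖ = 1
  next : ∀ j : Fin n, (j : ℕ) ≠ 0 →
    ∃ κ : Kernel ({k : Fin n // k < j} → EuclideanSpace ℝ (Fin d)) (EuclideanSpace ℝ (Fin d)),
      IsMarkovKernel κ ∧
      HasCondDistrib (v j) (fun s (k : {k : Fin n // k < j}) => v k s) κ P ∧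
      ∀ᵐ s ∂P, ∃ W : Submodule ℝ (EuclideanSpace ℝ (Fin d)),
        m ≤ Module.finrank ℝ W ∧ κ (fun k => v k s) = unitSphereUniform W

section ConditionallySpherical

variable {S : Type*} [MeasurableSpace S] {P : Measure S} {n d m : ℕ}
  {v : Fin n → S → EuclideanSpace ℝ (Fin d)}

lemma IsRandomUnitVectors.isConditionallySpherical (hv : IsRandomUnitVectors P v) :
    IsConditionallySpherical P (d - 1) v where
  norm_first i hi := ae_iff.2 <|
    ((hv.first i hi).measure_eq measurableSet_norm_ne_one).trans (unitSphereUniform_norm_ne_one _)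
  next j hj := by
    obtain ⟨κ, hκ, hcond, hunif⟩ := hv.next ⟨j - 1, by omega⟩ j (Nat.sub_add_cancel (by omega))
    exact ⟨κ, hκ, hcond,
      hunif.mono fun s hs => ⟨_, pred_le_finrank_orthogonal_span_singleton _, hs⟩⟩

namespace IsConditionallySpherical

variable [IsProbabilityMeasure P]

lemma ae_norm_eq_one (hv : IsConditionallySpherical P m v) (j : Fin n) :
    ∀ᵐ s ∂P, ‖v j s‖ = 1 := by
  by_cases hj : (j : ℕ) = 0
  · exact hv.norm_first j hj
  · obtain ⟨κ, _, hcond, hunif⟩ := hv.next j hj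
    refine ae_iff.2 <| le_zero_iff.1 <|
      measure_le_of_ae_condDistrib_le hcond (measurable_snd measurableSet_norm_ne_one) ?_
    filter_upwards [hunif] with s ⟨W, _, hs⟩
    rw [hs]
    exact (unitSphereUniform_norm_ne_one W).le

lemma measure_abs_inner_ge_le_of_lt (hv : IsConditionallySpherical P m v) {τ : ℝ} (hτ : 0 ≤ τ)
    (hτ2 : τ ^ 2 ≤ 1 / 2) {i j : Fin n} (hij : i < j) :
    P {s | τ ≤ |⟪v i s, v j s⟫_ℝ|} ≤ ENNReal.ofReal (2 * Real.exp (-(m * τ ^ 2 / 2))) := by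
  obtain ⟨κ, _, hcond, hunif⟩ := hv.next j (by have : (i : ℕ) < j := hij; omega)
  have hmeas : MeasurableSet {p : ({k : Fin n // k < j} → EuclideanSpace ℝ (Fin d)) ×
      EuclideanSpace ℝ (Fin d) | τ ≤ |⟪p.1 ⟨i, hij⟩, p.2⟫_ℝ|} :=
    measurableSet_le measurable_const (by fun_prop)
  refine measure_le_of_ae_condDistrib_le hcond hmeas ?_
  filter_upwards [hunif, hv.ae_norm_eq_one i] with s ⟨W, hW, hs⟩ hi
  rw [hs]
  refine (unitSphereUniform_abs_inner_ge_le W hi.le hτ hτ2).trans ?_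
  gcongr

lemma measure_abs_inner_ge_le (hv : IsConditionallySpherical P m v) {τ : ℝ} (hτ : 0 ≤ τ)
    (hτ2 : τ ^ 2 ≤ 1 / 2) {i j : Fin n} (hij : i ≠ j) :
    P {s | τ ≤ |⟪v i s, v j s⟫_ℝ|} ≤ ENNReal.ofReal (2 * Real.exp (-(m * τ ^ 2 / 2))) := by
  rcases hij.lt_or_gt with hlt | hgt
  · exact hv.measure_abs_inner_ge_le_of_lt hτ hτ2 hlt
  · simp_rw [real_inner_comm (v j _) (v i _)]
    exact hv.measure_abs_inner_ge_le_of_lt hτ hτ2 hgt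

lemma measure_not_isAlmostOrthonormal_le (hv : IsConditionallySpherical P m v) {τ : ℝ}
    (hτ : 0 ≤ τ) (hτ2 : τ ^ 2 ≤ 1 / 2) :
    P {s | ¬ IsAlmostOrthonormal τ fun i => v i s} ≤
      ENNReal.ofReal (n ^ 2 * (2 * Real.exp (-(m * τ ^ 2 / 2)))) := by
  let bad (p : Fin n × Fin n) : Set S := {s | p.1 ≠ p.2 ∧ τ ≤ |⟪v p.1 s, v p.2 s⟫_ℝ|}
  have hcover : {s | ¬ IsAlmostOrthonormal τ fun i => v i s} ≤ᵐ[P] ⋃ p, bad p := by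
    filter_upwards [ae_all_iff.2 hv.ae_norm_eq_one] with s hnorm hs
    by_contra hgood
    refine hs ⟨hnorm, fun i j hij => ?_⟩
    by_contra! hlt
    exact hgood (Set.mem_iUnion.2 ⟨(i, j), hij, hlt.le⟩)
  have hbad (p : Fin n × Fin n) :
      P (bad p) ≤ ENNReal.ofReal (2 * Real.exp (-(m * τ ^ 2 / 2))) := by
    by_cases hp : p.1 = p.2
    · simp [bad, hp]
    · exact (measure_mono fun s hs => hs.2).trans (hv.measure_abs_inner_ge_le hτ hτ2 hp)
  calc _ ≤ P (⋃ p, bad p) := measure_mono_ae hcover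
    _ ≤ ∑ p, P (bad p) := measure_iUnion_fintype_le _ _
    _ ≤ ∑ _p : Fin n × Fin n, ENNReal.ofReal (2 * Real.exp (-(m * τ ^ 2 / 2))) :=
        Finset.sum_le_sum fun p _ => hbad p
    _ = _ := by
        rw [ENNReal.ofReal_mul (p := (n : ℝ) ^ 2) (by positivity)]
        simp [sq]

end IsConditionallySpherical

end ConditionallySpherical

/-! ### Random weights -/

/-- A weight matrix of the directed path `0 → 1 → ⋯ → n - 1`: only the entries directly above the
diagonal may be different from zero. -/
def IsPathMatrix {R : Type*} [Zero R] {n : ℕ} (Λ : Matrix (Fin n) (Fin n) R) : Prop :=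
  ∀ i j : Fin n, (i : ℕ) + 1 ≠ j → Λ i j = 0

/-- A random weight matrix of the directed path whose weights are uniformly distributed on
`[-h, h]`, with an arbitrary joint distribution. -/
structure HasUniformPathWeights {S : Type*} [MeasurableSpace S] (P : Measure S) {n : ℕ} (h : ℝ)
    (Λ : S → Matrix (Fin n) (Fin n) ℝ) : Prop where
  isPathMatrix : ∀ s, IsPathMatrix (Λ s)
  law : ∀ i j : Fin n, (i : ℕ) + 1 = j → HasLaw (fun s => Λ s i j) (uniformSymm h) P

lemma uniformSymm_ae_abs_le {h : ℝ} (hh : 0 ≤ h) : ∀ᵐ x ∂uniformSymm h, |x| ≤ h := by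
  unfold uniformSymm
  split_ifs
  · simpa using hh
  · filter_upwards [ae_cond_mem measurableSet_Icc] with x hx
    exact abs_le.2 hx

lemma uniformSymm_abs_lt_mul_le {h : ℝ} (hh : 0 ≤ h) (c : ℝ) :
    uniformSymm h {x | |x| < h * c} ≤ ENNReal.ofReal c := by
  rcases hh.eq_or_lt with rfl | hpos
  · simp [(abs_nonneg _).not_gt]
  rw [uniformSymm, if_neg hpos.ne', cond_apply measurableSet_Icc, Real.volume_Icc]
  have hsub : Set.Icc (-h) h ∩ {x | |x| < h * c} ⊆ Set.Ioo (-(h * c)) (h * c) :=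
    fun x hx => abs_lt.1 hx.2
  calc _ ≤ (ENNReal.ofReal (h - -h))⁻¹ * ENNReal.ofReal (h * c - -(h * c)) := by
        gcongr
        exact (measure_mono hsub).trans_eq Real.volume_Ioo
    _ = ENNReal.ofReal ((h - -h)⁻¹ * (h * c - -(h * c))) := by
        rw [← ENNReal.ofReal_inv_of_pos (by linarith), ← ENNReal.ofReal_mul (by
          rw [inv_nonneg]; linarith)]
    _ = ENNReal.ofReal c := by
        congr 1
        field_simp

section UniformPathWeights

variable {S : Type*} [MeasurableSpace S] {P : Measure S} {n : ℕ} {h : ℝ}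
  {Λ : S → Matrix (Fin n) (Fin n) ℝ}

lemma IsRandomPathWeights.hasUniformPathWeights (hΛ : IsRandomPathWeights P h Λ) :
    HasUniformPathWeights P h Λ :=
  ⟨hΛ.zero, hΛ.law⟩

namespace HasUniformPathWeights

lemma ae_abs_le (hΛ : HasUniformPathWeights P h Λ) (hh : 0 ≤ h) (i j : Fin n) :
    ∀ᵐ s ∂P, |Λ s i j| ≤ h := by
  by_cases hij : (i : ℕ) + 1 = j
  · exact ((hΛ.law i j hij).ae_iff (p := (|·| ≤ h)) (measurableSet_setOfPred.1
      (measurableSet_le (by fun_prop) measurable_const))).2 (uniformSymm_ae_abs_le hh)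
  · simp [hΛ.isPathMatrix _ i j hij, hh]

lemma measure_exists_abs_lt_mul_le (hΛ : HasUniformPathWeights P h Λ) (hh : 0 ≤ h) (c : ℝ) :
    P {s | ∃ i j : Fin n, (i : ℕ) + 1 = j ∧ |Λ s i j| < h * c} ≤ ENNReal.ofReal (n * c) := by
  have hunion : {s | ∃ i j : Fin n, (i : ℕ) + 1 = j ∧ |Λ s i j| < h * c} =
      ⋃ i : Fin n, {s | ∃ j : Fin n, (i : ℕ) + 1 = j ∧ |Λ s i j| < h * c} := by
    ext s
    simp
  have hrow (i : Fin n) :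
      P {s | ∃ j : Fin n, (i : ℕ) + 1 = j ∧ |Λ s i j| < h * c} ≤ ENNReal.ofReal c := by
    by_cases hi : ∃ j : Fin n, (i : ℕ) + 1 = j
    · obtain ⟨j, hij⟩ := hi
      have hj (k : Fin n) : (i : ℕ) + 1 = k ↔ k = j := by rw [hij, Fin.ext_iff, eq_comm]
      simp only [hj, exists_eq_left]
      have hmeas : MeasurableSet {x : ℝ | |x| < h * c} :=
        measurableSet_lt (by fun_prop) measurable_const
      exact ((hΛ.law i j hij).measure_eq hmeas).trans_le (uniformSymm_abs_lt_mul_le hh c)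
    · push Not at hi
      simp [hi]
  rw [hunion]
  calc _ ≤ ∑ i : Fin n, P {s | ∃ j : Fin n, (i : ℕ) + 1 = j ∧ |Λ s i j| < h * c} :=
        measure_iUnion_fintype_le _ _
    _ ≤ ∑ _i : Fin n, ENNReal.ofReal c := Finset.sum_le_sum fun i _ => hrow i
    _ = ENNReal.ofReal (n * c) := by
        rw [ENNReal.ofReal_mul (by positivity)]
        simp

end HasUniformPathWeights

end UniformPathWeights

/-! ### The solution of the structural equations -/

section StructuralSolution

variable {ι R M : Type*} [Fintype ι] [CommRing R] [AddCommGroup M] [Module R M]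

lemma det_one_sub_of_strictUpperTriangular [LinearOrder ι] {Λ : Matrix ι ι R}
    (hΛ : ∀ i j, j ≤ i → Λ i j = 0) : (1 - Λ).det = 1 := by
  have hupper : (1 - Λ).IsUpperTriangular := fun i j (hij : j < i) => by
    simp [Matrix.one_apply_ne hij.ne', hΛ i j hij.le]
  rw [Matrix.det_of_isUpperTriangular hupper]
  simp [fun i => hΛ i i le_rfl]

variable [DecidableEq ι]

/-- The solution `w` of the linear structural equations `w j = v j + ∑ i, Λ i j • w i` with noise
`v`, provided that `1 - Λ` is invertible. -/
noncomputable def structuralSolution (Λ : Matrix ι ι R) (v : ι → M) (j : ι) : M :=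
  ∑ k, (1 - Λ)⁻¹ k j • v k

lemma structuralSolution_eq_add_sum {Λ : Matrix ι ι R} (hΛ : IsUnit (1 - Λ).det) (v : ι → M)
    (j : ι) :
    structuralSolution Λ v j = v j + ∑ i, Λ i j • structuralSolution Λ v i := by
  have hinv : (1 - Λ)⁻¹ = 1 + (1 - Λ)⁻¹ * Λ := by
    have hmul := Matrix.nonsing_inv_mul _ hΛ
    rwa [Matrix.mul_sub, Matrix.mul_one, sub_eq_iff_eq_add] at hmul
  calc structuralSolution Λ v j = v j + ∑ k, ((1 - Λ)⁻¹ * Λ) k j • v k := by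
        conv_lhs => rw [structuralSolution, hinv]
        simp [Matrix.add_apply, add_smul, Finset.sum_add_distrib, Matrix.one_apply]
    _ = v j + ∑ i, Λ i j • structuralSolution Λ v i := by
        simp_rw [structuralSolution, Finset.smul_sum, Matrix.mul_apply, Finset.sum_smul, smul_smul]
        rw [Finset.sum_comm]
        simp_rw [mul_comm]

lemma dataCovariance_gram {E : Type*} [NormedAddCommGroup E] [InnerProductSpace ℝ E] {n : ℕ}
    (Λ : Matrix (Fin n) (Fin n) ℝ) (v : Fin n → E) :
    dataCovariance Λ (Matrix.gram ℝ v) = Matrix.gram ℝ (structuralSolution Λ v) := by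
  ext i j
  simp_rw [dataCovariance, Matrix.gram_apply, structuralSolution, Matrix.mul_apply, inner_sum,
    sum_inner, real_inner_smul_left, real_inner_smul_right, Matrix.gram_apply,
    Matrix.transpose_apply, Finset.sum_mul]
  refine Finset.sum_congr rfl fun l _ => Finset.sum_congr rfl fun k _ => ?_
  ring

end StructuralSolution

@[elab_as_elim]
lemma path_induction {n : ℕ} {motive : Fin n → Prop} (zero : ∀ i : Fin n, (i : ℕ) = 0 → motive i)
    (succ : ∀ i j : Fin n, (i : ℕ) + 1 = j → motive i → motive j) (i : Fin n) : motive i := by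
  obtain ⟨k, hk⟩ := i
  induction k with
  | zero => exact zero _ rfl
  | succ k ih => exact succ ⟨k, by omega⟩ _ rfl (ih _)

/- For `h² ≤ 1/2` the function `l ↦ l (1 - h l)` is increasing on `[0, h]`. -/
lemma mul_le_mul_add_sq_mul {h l A B : ℝ} (hl : 0 ≤ l) (hlh : l ≤ h) (hh : h ^ 2 ≤ 1 / 2)
    (hA : 0 ≤ A) (hAB : (1 - h ^ 2) * A ≤ B) : l * A ≤ h * (B + l ^ 2 * A) := by
  have hmono : l * (1 - h * l) ≤ h * (1 - h ^ 2) := by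
    have hfactor : 0 ≤ (h - l) * (1 - h * (h + l)) :=
      mul_nonneg (sub_nonneg.2 hlh) (by nlinarith)
    linarith
  calc l * A = l * (1 - h * l) * A + h * (l ^ 2 * A) := by ring
    _ ≤ h * (1 - h ^ 2) * A + h * (l ^ 2 * A) := by gcongr
    _ = h * ((1 - h ^ 2) * A) + h * (l ^ 2 * A) := by ring
    _ ≤ h * B + h * (l ^ 2 * A) := by
        gcongr
        exact hl.trans hlh
    _ = h * (B + l ^ 2 * A) := by ring

namespace IsPathMatrix

section Algebra

variable {R M : Type*} [CommRing R] [AddCommGroup M] [Module R M] {n : ℕ}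
  {Λ : Matrix (Fin n) (Fin n) R}

lemma isUnit_det_one_sub (hΛ : IsPathMatrix Λ) : IsUnit (1 - Λ).det := by
  have hdet : (1 - Λ).det = 1 :=
    det_one_sub_of_strictUpperTriangular fun i j (hji : (j : ℕ) ≤ i) => hΛ i j (by omega)
  exact hdet ▸ isUnit_one

lemma structuralSolution_of_val_eq_zero (hΛ : IsPathMatrix Λ) (v : Fin n → M) {j : Fin n}
    (hj : (j : ℕ) = 0) : structuralSolution Λ v j = v j := by
  rw [structuralSolution_eq_add_sum hΛ.isUnit_det_one_sub, Finset.sum_eq_zero, add_zero]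
  intro i _
  rw [hΛ i j (by omega), zero_smul]

lemma structuralSolution_of_val_add_one_eq (hΛ : IsPathMatrix Λ) (v : Fin n → M) {i j : Fin n}
    (hij : (i : ℕ) + 1 = j) :
    structuralSolution Λ v j = v j + Λ i j • structuralSolution Λ v i := by
  rw [structuralSolution_eq_add_sum hΛ.isUnit_det_one_sub, Fintype.sum_eq_single i]
  intro k hk
  rw [hΛ k j (fun hkj => hk (Fin.ext (by omega))), zero_smul]

end Algebra

/-! ### Covariances along the path -/

variable {E : Type*} [NormedAddCommGroup E] [InnerProductSpace ℝ E] {n : ℕ}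
  {Λ : Matrix (Fin n) (Fin n) ℝ} {v : Fin n → E} {h σ τ : ℝ}

lemma abs_inner_structuralSolution_noise_le (hΛ : IsPathMatrix Λ) (hΛh : ∀ i j, |Λ i j| ≤ h)
    (hh1 : h < 1) (hv : IsAlmostOrthonormal τ v) (i : Fin n) {j : Fin n} (hij : i < j) :
    |⟪structuralSolution Λ v i, v j⟫_ℝ| ≤ τ / (1 - h) := by
  have hh : 0 ≤ h := (abs_nonneg _).trans (hΛh i j)
  have hτ : 0 ≤ τ := (abs_nonneg _).trans (hv.abs_inner_le hij.ne)
  have hsub : 0 < 1 - h := sub_pos.2 hh1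
  induction i using path_induction with
  | zero i hi =>
    rw [hΛ.structuralSolution_of_val_eq_zero v hi]
    exact (hv.abs_inner_le hij.ne).trans (le_div_self hτ hsub (by linarith))
  | succ i k hik ih =>
    have hikj : i < j := lt_trans (Fin.lt_def.2 (by omega)) hij
    rw [hΛ.structuralSolution_of_val_add_one_eq v hik, inner_add_left, real_inner_smul_left]
    calc _ ≤ |⟪v k, v j⟫_ℝ| + |Λ i k| * |⟪structuralSolution Λ v i, v j⟫_ℝ| := by
          rw [← abs_mul]
          exact abs_add_le _ _
      _ ≤ τ + h * (τ / (1 - h)) := by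
          gcongr
          exacts [hv.abs_inner_le hij.ne, hΛh i k, ih hikj]
      _ = τ / (1 - h) := by
          field_simp
          ring

lemma abs_norm_sq_structuralSolution_sub_le (hΛ : IsPathMatrix Λ) {i j : Fin n}
    (hij : (i : ℕ) + 1 = j) (hΛ1 : |Λ i j| ≤ 1) (hvj : ‖v j‖ = 1)
    (hcross : |⟪structuralSolution Λ v i, v j⟫_ℝ| ≤ σ) :
    |‖structuralSolution Λ v j‖ ^ 2 - (1 + Λ i j ^ 2 * ‖structuralSolution Λ v i‖ ^ 2)| ≤
      2 * σ := by
  have expand : ‖structuralSolution Λ v j‖ ^ 2 -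
      (1 + Λ i j ^ 2 * ‖structuralSolution Λ v i‖ ^ 2) =
        2 * (Λ i j * ⟪structuralSolution Λ v i, v j⟫_ℝ) := by
    rw [hΛ.structuralSolution_of_val_add_one_eq v hij, norm_add_sq_real, hvj,
      real_inner_smul_right, real_inner_comm, norm_smul, mul_pow, Real.norm_eq_abs, sq_abs]
    ring
  rw [expand, abs_mul, abs_two, abs_mul]
  gcongr
  exact (mul_le_of_le_one_left (abs_nonneg _) hΛ1).trans hcross

lemma abs_inner_structuralSolution_le (hΛ : IsPathMatrix Λ) {i j : Fin n} (hij : (i : ℕ) + 1 = j)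
    (k : Fin n) (hcross : |⟪structuralSolution Λ v k, v j⟫_ℝ| ≤ σ) :
    |⟪structuralSolution Λ v k, structuralSolution Λ v j⟫_ℝ| ≤
      |Λ i j| * |⟪structuralSolution Λ v k, structuralSolution Λ v i⟫_ℝ| + σ := by
  rw [hΛ.structuralSolution_of_val_add_one_eq v hij, inner_add_right, real_inner_smul_right,
    ← abs_mul, add_comm]
  exact (abs_add_le _ _).trans (by gcongr)

lemma one_sub_le_norm_sq_structuralSolution (hΛ : IsPathMatrix Λ) (hΛ1 : ∀ i j, |Λ i j| ≤ 1)
    (hv : ∀ i, ‖v i‖ = 1) (hσ : 0 ≤ σ)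
    (hcross : ∀ i j, i < j → |⟪structuralSolution Λ v i, v j⟫_ℝ| ≤ σ) (j : Fin n) :
    1 - 2 * σ ≤ ‖structuralSolution Λ v j‖ ^ 2 := by
  induction j using path_induction with
  | zero j hj =>
    rw [hΛ.structuralSolution_of_val_eq_zero v hj, hv]
    linarith
  | succ i j hij _ =>
    have hvar := hΛ.abs_norm_sq_structuralSolution_sub_le hij (hΛ1 i j) (hv j)
      (hcross i j (Fin.lt_def.2 (by omega)))
    have hnonneg : 0 ≤ Λ i j ^ 2 * ‖structuralSolution Λ v i‖ ^ 2 := by positivity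
    linarith [(abs_le.1 hvar).1]

lemma mul_norm_sq_structuralSolution_le (hΛ : IsPathMatrix Λ) (hΛh : ∀ i j, |Λ i j| ≤ h)
    (hh1 : h ≤ 1) (hv : ∀ i, ‖v i‖ = 1) (hσ : 0 ≤ σ)
    (hcross : ∀ i j, i < j → |⟪structuralSolution Λ v i, v j⟫_ℝ| ≤ σ) (j : Fin n) :
    (1 - h ^ 2) * ‖structuralSolution Λ v j‖ ^ 2 ≤ 1 + 2 * σ := by
  have hh : 0 ≤ h := (abs_nonneg _).trans (hΛh j j)
  have hsq : 0 ≤ 1 - h ^ 2 := sub_nonneg.2 (pow_le_one₀ hh hh1)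
  induction j using path_induction with
  | zero j hj =>
    rw [hΛ.structuralSolution_of_val_eq_zero v hj, hv]
    nlinarith
  | succ i j hij ih =>
    have hvar := hΛ.abs_norm_sq_structuralSolution_sub_le hij ((hΛh i j).trans hh1) (hv j)
      (hcross i j (Fin.lt_def.2 (by omega)))
    have hΛsq : Λ i j ^ 2 ≤ h ^ 2 := sq_le_sq' (abs_le.1 (hΛh i j)).1 (abs_le.1 (hΛh i j)).2
    calc (1 - h ^ 2) * ‖structuralSolution Λ v j‖ ^ 2
        ≤ (1 - h ^ 2) * (1 + 2 * σ + Λ i j ^ 2 * ‖structuralSolution Λ v i‖ ^ 2) := by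
          gcongr
          linarith [(abs_le.1 hvar).2]
      _ = (1 - h ^ 2) * (1 + 2 * σ) +
            Λ i j ^ 2 * ((1 - h ^ 2) * ‖structuralSolution Λ v i‖ ^ 2) := by ring
      _ ≤ (1 - h ^ 2) * (1 + 2 * σ) + h ^ 2 * (1 + 2 * σ) := by gcongr
      _ = 1 + 2 * σ := by ring

lemma abs_inner_consecutive_le (hΛ : IsPathMatrix Λ) (hΛh : ∀ i j, |Λ i j| ≤ h)
    (hh : h ^ 2 ≤ 1 / 2) (hv : ∀ i, ‖v i‖ = 1) (hσ : 0 ≤ σ)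
    (hcross : ∀ i j, i < j → |⟪structuralSolution Λ v i, v j⟫_ℝ| ≤ σ) {i j : Fin n}
    (hij : (i : ℕ) + 1 = j) :
    |⟪structuralSolution Λ v i, structuralSolution Λ v j⟫_ℝ| ≤
      h * ‖structuralSolution Λ v j‖ ^ 2 + 5 * σ := by
  have hh0 : 0 ≤ h := (abs_nonneg _).trans (hΛh i j)
  have hh1 : h ≤ 1 := by nlinarith
  have hij' : i < j := Fin.lt_def.2 (by omega)
  have hvar := hΛ.abs_norm_sq_structuralSolution_sub_le hij ((hΛh i j).trans hh1) (hv j)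
    (hcross i j hij')
  have hupper := hΛ.mul_norm_sq_structuralSolution_le hΛh hh1 hv hσ hcross i
  calc |⟪structuralSolution Λ v i, structuralSolution Λ v j⟫_ℝ|
      ≤ |Λ i j| * ‖structuralSolution Λ v i‖ ^ 2 + σ := by
        simpa only [real_inner_self_eq_norm_sq, abs_of_nonneg (sq_nonneg ‖_‖)] using
          hΛ.abs_inner_structuralSolution_le hij i (hcross i j hij')
    _ ≤ h * (1 + 2 * σ + Λ i j ^ 2 * ‖structuralSolution Λ v i‖ ^ 2) + σ := by
        rw [← sq_abs (Λ i j), add_le_add_iff_right]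
        exact mul_le_mul_add_sq_mul (abs_nonneg _) (hΛh i j) hh (sq_nonneg _) hupper
    _ ≤ h * (‖structuralSolution Λ v j‖ ^ 2 + 4 * σ) + σ := by
        rw [add_le_add_iff_right]
        exact mul_le_mul_of_nonneg_left (by linarith [(abs_le.1 hvar).1]) hh0
    _ ≤ h * ‖structuralSolution Λ v j‖ ^ 2 + 5 * σ := by nlinarith

theorem locallyDominated_dataCovariance_gram (hΛ : IsPathMatrix Λ) (hΛh : ∀ i j, |Λ i j| ≤ h)
    (hh : h ^ 2 ≤ 1 / 2) (hv : IsAlmostOrthonormal τ v) (hτ : 0 ≤ τ) (hτh : 4 * τ ≤ 1 - h) :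
    LocallyDominated (h + 12 * (τ / (1 - h))) (dataCovariance Λ (Matrix.gram ℝ v)) := by
  have hh1 : h < 1 := by nlinarith
  have hcross (i j : Fin n) (hij : i < j) : |⟪structuralSolution Λ v i, v j⟫_ℝ| ≤ τ / (1 - h) :=
    hΛ.abs_inner_structuralSolution_noise_le hΛh hh1 hv i hij
  have hσ : 0 ≤ τ / (1 - h) := div_nonneg hτ (by linarith)
  have hσ4 : τ / (1 - h) ≤ 1 / 4 := by
    rw [div_le_iff₀ (by linarith)]
    linarith
  generalize τ / (1 - h) = σ at hcross hσ hσ4 ⊢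
  have hΛ1 (i j : Fin n) : |Λ i j| ≤ 1 := (hΛh i j).trans hh1.le
  have habsorb (i : Fin n) : σ ≤ 2 * σ * ‖structuralSolution Λ v i‖ ^ 2 := by
    nlinarith [hΛ.one_sub_le_norm_sq_structuralSolution hΛ1 hv.norm_eq_one hσ hcross i]
  have hpred {i j : Fin n} (hij : (i : ℕ) + 1 = j) :=
    hΛ.abs_inner_consecutive_le hΛh hh hv.norm_eq_one hσ hcross hij
  have hstep {i j : Fin n} (hij : (i : ℕ) + 1 = j) (k : Fin n) (hki : k ≤ i) :=
    hΛ.abs_inner_structuralSolution_le hij k (hcross k j (by rw [Fin.lt_def]; omega))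
  intro i
  simp only [dataCovariance_gram, Matrix.gram_apply, real_inner_self_eq_norm_sq]
  refine ⟨fun j hji => ?_, fun k hik => ?_, fun j k hji hik => ?_⟩
  · linarith [hpred hji, habsorb i]
  · have hsucc := hstep hik i le_rfl
    rw [real_inner_self_eq_norm_sq,
      abs_of_nonneg (sq_nonneg ‖structuralSolution Λ v i‖)] at hsucc
    have hweight := mul_le_mul_of_nonneg_right (hΛh i k) (sq_nonneg ‖structuralSolution Λ v i‖)
    linarith [habsorb i]
  · have hskip := hstep hik j (Fin.le_def.2 (by omega))
    have hweight := mul_le_of_le_one_left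
      (abs_nonneg ⟪structuralSolution Λ v j, structuralSolution Λ v i⟫_ℝ) (hΛ1 i k)
    linarith [hpred hji, habsorb i]

end IsPathMatrix

/-! ### Probability bounds and asymptotics -/

lemma measure_not_locallyDominated_le {S : Type*} [MeasurableSpace S] {P : Measure S}
    [IsProbabilityMeasure P] {n d m : ℕ} {Λ : S → Matrix (Fin n) (Fin n) ℝ}
    {v : Fin n → S → EuclideanSpace ℝ (Fin d)} {h τ : ℝ} (hΛ : HasUniformPathWeights P h Λ)
    (hv : IsConditionallySpherical P m v) (hh : 0 ≤ h) (hh2 : h ^ 2 ≤ 1 / 2) (hτ : 0 ≤ τ)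
    (hτh : 4 * τ ≤ 1 - h) :
    P {s | ¬ LocallyDominated (h + 12 * (τ / (1 - h)))
        (dataCovariance (Λ s) (Matrix.gram ℝ fun i => v i s))} ≤
      ENNReal.ofReal (n ^ 2 * (2 * Real.exp (-(m * τ ^ 2 / 2)))) := by
  refine le_trans (measure_mono_ae ?_)
    (hv.measure_not_isAlmostOrthonormal_le hτ (by nlinarith : τ ^ 2 ≤ 1 / 2))
  filter_upwards [ae_all_iff.2 fun i => ae_all_iff.2 (hΛ.ae_abs_le hh i)] with s hs
  exact mt fun horth =>
    (hΛ.isPathMatrix s).locallyDominated_dataCovariance_gram hs hh2 horth hτ hτh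

lemma one_sub_le_measureReal {S : Type*} [MeasurableSpace S] {P : Measure S}
    [IsProbabilityMeasure P] {G : Set S} {δ : ℝ} (hδ : 0 ≤ δ) (hG : P Gᶜ ≤ ENNReal.ofReal δ) :
    1 - δ ≤ P.real G := by
  have huniv : 1 ≤ P.real G + P.real Gᶜ := by
    simpa using measureReal_union_le (μ := P) G Gᶜ
  have hcompl : P.real Gᶜ ≤ δ := ENNReal.toReal_le_of_le_ofReal hδ hG
  linarith

/-- A bound that, with high probability, holds for all inner products of `n` random unit vectors
with `m` degrees of freedom each. It is chosen between `√(log n / m)`, above which the union bound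
over all pairs works, and `1`, so that it tends to `0` when `log n = o(m)`. -/
noncomputable def correlationScale (n m : ℕ) : ℝ :=
  √√(Real.log n / m)

lemma correlationScale_nonneg (n m : ℕ) : 0 ≤ correlationScale n m :=
  Real.sqrt_nonneg _

lemma tendsto_correlationScale {m : ℕ → ℕ}
    (hm : (fun n : ℕ => Real.log n) =o[atTop] fun n => (m n : ℝ)) :
    Tendsto (fun n => correlationScale n (m n)) atTop (𝓝 0) := by
  simpa [correlationScale] using hm.tendsto_div_nhds_zero.sqrt.sqrt

lemma sq_mul_exp_correlationScale_le {n m : ℕ} (hm : 36 * Real.log n ≤ m) :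
    (n : ℝ) ^ 2 * (2 * Real.exp (-(m * correlationScale n m ^ 2 / 2))) ≤ 2 / n := by
  rcases n.eq_zero_or_pos with rfl | hn
  · simp
  have hn' : (0 : ℝ) < n := Nat.cast_pos.2 hn
  have hlog : 0 ≤ Real.log n := Real.log_natCast_nonneg n
  have hexponent : 3 * Real.log n ≤ m * correlationScale n m ^ 2 / 2 := by
    rw [correlationScale, Real.sq_sqrt (Real.sqrt_nonneg _)]
    have hsq : m * √(Real.log n / m) ^ 2 = Real.log n := by
      rw [Real.sq_sqrt (by positivity)]
      exact mul_div_cancel_of_imp' fun hm0 => by rw [hm0] at hm; linarith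
    have hsmall : √(Real.log n / m) ≤ 1 / 6 := by
      refine Real.sqrt_le_iff.2 ⟨by norm_num, div_le_of_le_mul₀ (by positivity) (by norm_num) ?_⟩
      linarith
    calc 3 * Real.log n = 3 * m * √(Real.log n / m) * √(Real.log n / m) := by
          conv_lhs => rw [← hsq]
          ring
      _ ≤ 3 * m * √(Real.log n / m) * (1 / 6) := by gcongr
      _ = m * √(Real.log n / m) / 2 := by ring
  calc _ ≤ (n : ℝ) ^ 2 * (2 * Real.exp (-(3 * Real.log n))) := by gcongr
    _ = (n : ℝ) ^ 2 * (2 * ((n : ℝ) ^ 3)⁻¹) := by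
        rw [Real.exp_neg, ← Real.exp_log (pow_pos hn' 3), Real.log_pow]
        norm_num
    _ = 2 / n := by field_simp

lemma isLittleO_id_rpow_atTop {a : ℝ} (ha : 1 < a) :
    (fun x : ℝ => x) =o[atTop] fun x => x ^ a := by
  refine Asymptotics.isLittleO_of_tendsto'
    ((eventually_gt_atTop 0).mono fun x hx h0 => absurd h0 (Real.rpow_pos_of_pos hx a).ne') ?_
  refine (tendsto_rpow_neg_atTop (sub_pos.2 ha)).congr' ?_
  filter_upwards [eventually_gt_atTop 0] with x hx
  rw [neg_sub, Real.rpow_sub hx, Real.rpow_one]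

lemma isLittleO_log_pred_of_rpow_log_le {a : ℝ} (ha : 1 < a) {d : ℕ → ℕ}
    (hd : ∃ C : ℝ, 0 < C ∧ ∀ᶠ n : ℕ in atTop, C * Real.log n ^ a ≤ d n) :
    (fun n : ℕ => Real.log n) =o[atTop] fun n => ((d n - 1 : ℕ) : ℝ) := by
  obtain ⟨C, hC, hd⟩ := hd
  have hlog : Tendsto (fun n : ℕ => Real.log n) atTop atTop :=
    Real.tendsto_log_atTop.comp tendsto_natCast_atTop_atTop
  have hpow : (fun n : ℕ => Real.log n) =o[atTop] fun n : ℕ => Real.log n ^ a :=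
    (isLittleO_id_rpow_atTop ha).comp_tendsto hlog
  have hpred : (fun n : ℕ => Real.log n ^ a) =O[atTop] fun n => ((d n - 1 : ℕ) : ℝ) := by
    have hlarge : ∀ᶠ n : ℕ in atTop, 2 ≤ C * Real.log n ^ a :=
      (((tendsto_rpow_atTop (by linarith)).comp hlog).const_mul_atTop hC).eventually_ge_atTop 2
    refine .of_bound (2 / C) ?_
    filter_upwards [hd, hlarge] with n hdn hn
    have hd2 : 2 ≤ d n := by exact_mod_cast hn.trans hdn
    have hlogn : 0 ≤ Real.log n ^ a := Real.rpow_nonneg (Real.log_natCast_nonneg n) a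
    rw [Real.norm_of_nonneg hlogn, Real.norm_natCast, div_mul_eq_mul_div, le_div_iff₀ hC,
      Nat.cast_pred (by omega)]
    linarith
  exact hpow.trans_isBigO hpred

theorem theorem4p1_general {h : ℝ} (hh : 0 ≤ h) (hh2 : h ≤ 1 / √2) {m : ℕ → ℕ}
    (hm : (fun n : ℕ => Real.log n) =o[atTop] fun n => (m n : ℝ)) :
    ∃ ζ χ δ₁ δ₂ : ℕ → ℝ,
      (∀ n, 0 ≤ ζ n) ∧
      (∃ ε : ℕ → ℝ, Tendsto ε atTop (𝓝 0) ∧ ∀ n, ζ n ≤ h + ε n) ∧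
      (0 < h → ∃ c : ℝ, 0 < c ∧ ∀ᶠ n : ℕ in atTop, c * (n : ℝ) ^ (-2 : ℤ) ≤ χ n) ∧
      Tendsto δ₁ atTop (𝓝 0) ∧ Tendsto δ₂ atTop (𝓝 0) ∧
      ∀ᶠ n : ℕ in atTop,
        (0 ≤ δ₁ n ∧ δ₁ n < 1 / 2) ∧ (0 ≤ δ₂ n ∧ δ₂ n < 1 / 2) ∧
        ∀ (S : Type*) [MeasurableSpace S] (P : Measure S) [IsProbabilityMeasure P] (d : ℕ)
          (Λ : S → Matrix (Fin n) (Fin n) ℝ) (v : Fin n → S → EuclideanSpace ℝ (Fin d)),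
          HasUniformPathWeights P h Λ → IsConditionallySpherical P (m n) v →
            1 - δ₁ n ≤ P.real {s | LocallyDominated (ζ n)
              (dataCovariance (Λ s) (Matrix.gram ℝ (fun i => v i s)))} ∧
            1 - δ₂ n ≤ P.real {s | ∀ i j : Fin n, (i : ℕ) + 1 = j → χ n ≤ |Λ s i j|} := by
  have hhalf : h ^ 2 ≤ 1 / 2 := by
    simpa [div_pow] using pow_le_pow_left₀ hh hh2 2
  have hh1 : 0 < 1 - h := by nlinarith
  set τ : ℕ → ℝ := fun n => correlationScale n (m n)
  have hτ : ∀ n, 0 ≤ τ n := fun n => correlationScale_nonneg n (m n)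
  have hτlim : Tendsto τ atTop (𝓝 0) := tendsto_correlationScale hm
  have hδ (c : ℝ) : Tendsto (fun n : ℕ => c / n) atTop (𝓝 0) :=
    tendsto_const_div_atTop_nhds_zero_nat c
  refine ⟨fun n => h + 12 * (τ n / (1 - h)), fun n => h * (n : ℝ) ^ (-2 : ℤ), fun n => 2 / n,
    fun n => 1 / n, fun n => add_nonneg hh (mul_nonneg (by norm_num) (div_nonneg (hτ n) hh1.le)),
    ⟨_, by simpa using (hτlim.div_const (1 - h)).const_mul 12, fun n => le_rfl⟩,
    fun hpos => ⟨h, hpos, .of_forall fun n => le_rfl⟩, hδ 2, hδ 1, ?_⟩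
  filter_upwards [(hδ 2).eventually_lt_const one_half_pos, (hδ 1).eventually_lt_const one_half_pos,
    hτlim.eventually_le_const (show 0 < (1 - h) / 4 by linarith),
    hm.bound (show (0 : ℝ) < 1 / 36 by norm_num)] with n hδ₁ hδ₂ hτn hmn
  refine ⟨⟨by positivity, hδ₁⟩, ⟨by positivity, hδ₂⟩, fun S _ P _ d Λ v hΛ hv => ⟨?_, ?_⟩⟩
  · refine one_sub_le_measureReal (by positivity) <|
      (measure_not_locallyDominated_le hΛ hv hh hhalf (hτ n) (by linarith)).trans <|
        ENNReal.ofReal_le_ofReal (sq_mul_exp_correlationScale_le ?_)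
    rw [Real.norm_eq_abs, Real.norm_natCast] at hmn
    linarith [le_abs_self (Real.log n)]
  · refine one_sub_le_measureReal (by positivity) ?_
    simp only [Set.compl_ofPred, not_forall, not_le, exists_prop]
    refine (hΛ.measure_exists_abs_lt_mul_le hh _).trans_eq ?_
    congr 1
    field_simp

theorem theorem4p1 (h : ℝ) (h_nonneg : 0 ≤ h) (h_lt : h < 1 / Real.sqrt 2)
    (a : ℝ) (ha : 1 < a) (d : ℕ → ℕ)
    (hd : ∃ C : ℝ, 0 < C ∧ ∀ᶠ n : ℕ in atTop, C * Real.log n ^ a ≤ d n) :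
    ∃ ζ χ δ₁ δ₂ : ℕ → ℝ,
      (∀ n, 0 ≤ ζ n) ∧
      (∃ ε : ℕ → ℝ, Tendsto ε atTop (𝓝 0) ∧ ∀ n, ζ n ≤ h + ε n) ∧
      (0 < h → ∃ c : ℝ, 0 < c ∧ ∀ᶠ n : ℕ in atTop, c * (n : ℝ) ^ (-2 : ℤ) ≤ χ n) ∧
      Tendsto δ₁ atTop (𝓝 0) ∧ Tendsto δ₂ atTop (𝓝 0) ∧
      ∀ᶠ n : ℕ in atTop,
        (0 ≤ δ₁ n ∧ δ₁ n < 1 / 2) ∧ (0 ≤ δ₂ n ∧ δ₂ n < 1 / 2) ∧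
        ∀ (S : Type*) [MeasurableSpace S] (P : Measure S) [IsProbabilityMeasure P]
          (Λ : S → Matrix (Fin n) (Fin n) ℝ)
          (v : Fin n → S → EuclideanSpace ℝ (Fin (d n))),
          IsRandomPathWeights P h Λ → IsRandomUnitVectors P v →
            1 - δ₁ n ≤ P.real {s | LocallyDominated (ζ n)
              (dataCovariance (Λ s) (Matrix.gram ℝ (fun i => v i s)))} ∧
            1 - δ₂ n ≤ P.real {s | ∀ i j : Fin n, (i : ℕ) + 1 = j → χ n ≤ |Λ s i j|} := by
  obtain ⟨ζ, χ, δ₁, δ₂, hζ, hε, hχ, hδ₁, hδ₂, H⟩ :=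
    theorem4p1_general h_nonneg h_lt.le (isLittleO_log_pred_of_rpow_log_le ha hd)
  exact ⟨ζ, χ, δ₁, δ₂, hζ, hε, hχ, hδ₁, hδ₂, H.mono fun n ⟨h₁, h₂, H⟩ => ⟨h₁, h₂,
    fun S _ P _ Λ v hΛ hv => H S P (d n) Λ v hΛ.hasUniformPathWeights hv.isConditionallySpherical⟩⟩
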